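/- A rectangular standard Young tableau of shape $m\times n$ is a filling of the cells of an $m\times n$ array by the numbers $1,\dots,mn$, each used exactly once, such that the entries strictly increase along every row (left to right) and down every column. For strictly increasing vectors $x\in\mathbb{R}^m$ and $y\in\mathbb{R}^n$ such that the $mn$ numbers $x_i+y_j$ ($1\le i\le m$, $1\le j\le n$) are pairwise distinct, let $\mathcal{T}(x\circ y)$ be the $m\times n$ tableau whose $(i,j)$ entry is the position of $x_i+y_j$ when these $mn$ numbers are listed in increasing order. A tableau is called realizable if it equals $\mathcal{T}(x\circ y)$ for some such $x$ and $y$. Let $m\colon\mathbb{N}\to\mathbb{N}$ be any function with $m(n)\ge 3$ for all $n$. Then the probability that a uniformly random $m(n)\times n$ standard Young tableau is realizable tends to $0$ as $n\to\infty$. -/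

import Mathlib

open Filter Topology

/-- A standard Young tableau of rectangular shape `m × n` (`m` rows, `n` columns): a filling of the
cells by the numbers `1, …, m * n`, each used exactly once, with strictly increasing rows and
columns. -/
@[ext]
structure RectSYT (m n : ℕ) where
  entry : Fin m → Fin n → ℕ
  bijOn : Set.BijOn (fun p : Fin m × Fin n => entry p.1 p.2) Set.univ (Set.Icc 1 (m * n))
  row_strictMono : ∀ i, StrictMono fun j => entry i j
  col_strictMono : ∀ j, StrictMono fun i => entry i j

/-- The outer sum `x ∘ y` of two vectors: the matrix with `(i, j)` entry `x i + y j`. -/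
def outerSum {m n : ℕ} (x : Fin m → ℝ) (y : Fin n → ℝ) : Matrix (Fin m) (Fin n) ℝ :=
  Matrix.of fun i j => x i + y j

/-- All entries of a matrix are pairwise distinct. -/
def HasDistinctEntries {m n : ℕ} (A : Matrix (Fin m) (Fin n) ℝ) : Prop :=
  Function.Injective fun p : Fin m × Fin n => A p.1 p.2

/-- The position (counted from `1`) of the `(i, j)` entry of `A` among all the entries of `A`,
listed in increasing order. -/
noncomputable def entryRank {m n : ℕ} (A : Matrix (Fin m) (Fin n) ℝ) (i : Fin m) (j : Fin n) : ℕ :=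
  (Finset.univ.filter fun p : Fin m × Fin n => A p.1 p.2 ≤ A i j).card

theorem entryRank_lt {m n : ℕ} {A : Matrix (Fin m) (Fin n) ℝ} {i k : Fin m} {j l : Fin n}
    (h : A i j < A k l) : entryRank A i j < entryRank A k l := by
  apply Finset.card_lt_card
  rw [Finset.ssubset_iff_of_subset]
  · exact ⟨(k, l), by simp, by simpa using h⟩
  · intro p hp
    simp only [Finset.mem_filter, Finset.mem_univ, true_and] at hp ⊢
    exact hp.trans h.le

theorem entryRank_bijOn {m n : ℕ} {A : Matrix (Fin m) (Fin n) ℝ} (hA : HasDistinctEntries A) :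
    Set.BijOn (fun p : Fin m × Fin n => entryRank A p.1 p.2) Set.univ (Set.Icc 1 (m * n)) := by
  have hinj : Function.Injective (fun p : Fin m × Fin n => entryRank A p.1 p.2) := by
    intro p q hpq
    rcases lt_trichotomy (A p.1 p.2) (A q.1 q.2) with h | h | h
    · exact absurd hpq (entryRank_lt h).ne
    · exact hA h
    · exact absurd hpq (entryRank_lt h).ne'
  have hmaps : ∀ p : Fin m × Fin n, entryRank A p.1 p.2 ∈ Finset.Icc 1 (m * n) := by
    intro p
    rw [Finset.mem_Icc]
    refine ⟨Finset.card_pos.2 ⟨p, by simp⟩, ?_⟩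
    exact (Finset.card_le_univ _).trans (by simp)
  have himg : Finset.univ.image (fun p : Fin m × Fin n => entryRank A p.1 p.2)
      = Finset.Icc 1 (m * n) := by
    apply Finset.eq_of_subset_of_card_le
    · intro k hk
      obtain ⟨p, -, rfl⟩ := Finset.mem_image.1 hk
      exact hmaps p
    · rw [Finset.card_image_of_injective _ hinj]
      simp
  refine ⟨fun p _ => by simpa using hmaps p, hinj.injOn, fun k hk => ?_⟩
  have hk' : k ∈ Finset.Icc 1 (m * n) := by simpa using hk
  rw [← himg] at hk'
  obtain ⟨p, -, hp⟩ := Finset.mem_image.1 hk'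
  exact ⟨p, trivial, hp⟩

/-- The tableau `𝒯(x ∘ y)` of two increasing vectors whose outer sum has distinct entries: each
cell carries the position of its entry in the total order of the entries of `x ∘ y`. -/
noncomputable def outerSumTableau {m n : ℕ} (x : Fin m → ℝ) (y : Fin n → ℝ)
    (hx : StrictMono x) (hy : StrictMono y) (hxy : HasDistinctEntries (outerSum x y)) :
    RectSYT m n where
  entry := entryRank (outerSum x y)
  bijOn := entryRank_bijOn hxy
  row_strictMono i j l h := entryRank_lt (by simpa [outerSum] using hy h)
  col_strictMono j i k h := entryRank_lt (by simpa [outerSum] using hx h)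

namespace RectSYT

/-- A rectangular tableau is realizable if it is `𝒯(x ∘ y)` for some increasing `x` and `y`
(for which the entries of `x ∘ y` are distinct). -/
def IsRealizable {m n : ℕ} (T : RectSYT m n) : Prop :=
  ∃ (x : Fin m → ℝ) (y : Fin n → ℝ) (hx : StrictMono x) (hy : StrictMono y)
    (hxy : HasDistinctEntries (outerSum x y)), T = outerSumTableau x y hx hy hxy

instance instFinite (m n : ℕ) : Finite (RectSYT m n) := by
  have hb : ∀ (T : RectSYT m n) (i : Fin m) (j : Fin n), T.entry i j < m * n + 1 := fun T i j =>
    Nat.lt_succ_of_le (T.bijOn.mapsTo (Set.mem_univ (i, j))).2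
  refine Finite.of_injective
    (fun (T : RectSYT m n) (i : Fin m) (j : Fin n) => (⟨T.entry i j, hb T i j⟩ : Fin (m * n + 1)))
    fun T T' h => ?_
  ext i j
  simpa using congrFun (congrFun h i) j

/-- There is at least one `m × n` tableau: a realizable one, from
`x = (0, n + 1, 2 (n + 1), …)` and `y = (0, 1, …, n - 1)`. -/
instance instNonempty (m n : ℕ) : Nonempty (RectSYT m n) := by
  have hx : StrictMono fun i : Fin m => ((n : ℝ) + 1) * (i : ℕ) := by
    intro i k h
    have : ((i : ℕ) : ℝ) < (k : ℕ) := by exact_mod_cast h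
    exact mul_lt_mul_of_pos_left this (by positivity)
  have hy : StrictMono fun j : Fin n => ((j : ℕ) : ℝ) := fun j l h => Nat.cast_lt.2 h
  refine ⟨outerSumTableau _ _ hx hy ?_⟩
  rintro ⟨i, j⟩ ⟨k, l⟩ h
  simp only [outerSum, Matrix.of_apply] at h
  have h' : (n + 1) * (i : ℕ) + (j : ℕ) = (n + 1) * (k : ℕ) + (l : ℕ) := by exact_mod_cast h
  have hj : (j : ℕ) < n + 1 := by omega
  have hl : (l : ℕ) < n + 1 := by omega
  have h1 : (i : ℕ) = k := by
    have := congrArg (· / (n + 1)) h'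
    simpa [Nat.mul_add_div, Nat.div_eq_of_lt hj, Nat.div_eq_of_lt hl] using this
  have h2 : (j : ℕ) = l := by rw [h1] at h'; omega
  exact Prod.ext (Fin.ext h1) (Fin.ext h2)

/-- Every set of tableaux is an event. -/
instance instMeasurableSpace (m n : ℕ) : MeasurableSpace (RectSYT m n) := ⊤

instance instDiscreteMeasurableSpace (m n : ℕ) : DiscreteMeasurableSpace (RectSYT m n) :=
  ⟨fun _ => trivial⟩

end RectSYT

/-!
Both kinds of tableaux are counted. By transposition one may assume that `m` is fixed or that
`m ≤ n`; see `RectSYT.realizableProb_comm`.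

*All tableaux.* Frobenius' formula, in the form of a lower bound, is proved for arbitrary shapes by
removing the cell with the largest entry (`exists_finset_isTableau`); its recursion is the partial
fraction identity `sum_prod_sub_one_div`. For rectangles it shows that there are at least
`(m ^ n / (n + m - 1).choose n) ^ m` tableaux (`pow_le_card_rectSYT_mul`). For fixed `m` this is
`m ^ (m n)` up to a polynomial factor in `n`.

*Realizable tableaux.* A realizable tableau is determined by the signs, at the point `(x, y)` of
`ℝ ^ (m + n)`, of the linear forms comparing two sums `x i + y j` in distinct columns. Up to sign
there are `H = (m (m - 1) + 1) * n.choose 2` of these, and shuffling the coordinates of `y` turns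
every realizable tableau into `n!` different sign patterns. The family of sign patterns of linear
forms in dimension `d` has VC dimension at most `d` (`vcDim_le_finrank`), so the Sauer–Shelah lemma
bounds the number of patterns by `∑ k ≤ m + n, H.choose k`. Division by `n!` shows that the number
of realizable tableaux is at most `(e² q / 2) ^ n (q n / 2) ^ m` with `q = m (m - 1) + 1`
(`ncard_isRealizable_le`).

For fixed `m ≥ 3` the ratio tends to zero because `e² q / 2 < m ^ m`; the tightest case is `m = 3`,
where `7 e² / 2 < 26 < 27`. For `64 ≤ m ≤ n` the ratio is at most `2 ^ (-n)`.
-/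

/-! ### A rational identity -/

/-- Partial fraction expansion of `∏ j, (z - 1 - v j) / (z - v j)`. -/
theorem prod_sub_one_div_eq_one_sub_sum {ι : Type*} [DecidableEq ι] {v : ι → ℝ}
    (hv : Function.Injective v) (s : Finset ι) :
    ∀ z : ℝ, (∀ i ∈ s, z ≠ v i) → ∏ j ∈ s, (z - 1 - v j) / (z - v j) =
      1 - ∑ i ∈ s, (∏ j ∈ s.erase i, (v i - 1 - v j) / (v i - v j)) / (z - v i) := by
  induction s using Finset.induction_on with
  | empty => simp
  | insert a s ha ih =>
    intro z hz
    have hza : z - v a ≠ 0 := sub_ne_zero.2 (hz a (by simp))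
    have hzi : ∀ i ∈ s, z ≠ v i := fun i hi => hz i (by simp [hi])
    have hai : ∀ i ∈ s, v a ≠ v i := fun i hi h => ha (hv h ▸ hi)
    rw [Finset.prod_insert ha, Finset.sum_insert ha, Finset.erase_insert ha, ih z hzi,
      ih (v a) hai]
    have key : ∀ i ∈ s,
        (∏ j ∈ (insert a s).erase i, (v i - 1 - v j) / (v i - v j)) / (z - v i) =
        (∏ j ∈ s.erase i, (v i - 1 - v j) / (v i - v j)) / (z - v i)
          - (∏ j ∈ s.erase i, (v i - 1 - v j) / (v i - v j)) / (z - v i) / (z - v a)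
          + (∏ j ∈ s.erase i, (v i - 1 - v j) / (v i - v j)) / (v a - v i) / (z - v a) := by
      intro i hi
      have hia : a ≠ i := fun h => ha (h ▸ hi)
      have h1 : z - v i ≠ 0 := sub_ne_zero.2 (hzi i hi)
      have h2 : v i - v a ≠ 0 := sub_ne_zero.2 (hai i hi).symm
      have h3 : v a - v i ≠ 0 := sub_ne_zero.2 (hai i hi)
      have h4 : v a - v i = -(v i - v a) := by ring
      rw [Finset.erase_insert_of_ne hia, Finset.prod_insert (by simp [ha]), h4]
      field_simp
      ring
    rw [Finset.sum_congr rfl key, Finset.sum_add_distrib, Finset.sum_sub_distrib,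
      ← Finset.sum_div, ← Finset.sum_div]
    field_simp
    ring

/-- The second identity is the recursion satisfied by Frobenius' formula for the number of standard
Young tableaux, divided by that formula. -/
theorem sum_prod_sub_one_div {ι : Type*} [DecidableEq ι] {v : ι → ℝ}
    (hv : Function.Injective v) (s : Finset ι) :
    ∑ i ∈ s, ∏ j ∈ s.erase i, (v i - 1 - v j) / (v i - v j) = s.card ∧
    ∑ i ∈ s, v i * ∏ j ∈ s.erase i, (v i - 1 - v j) / (v i - v j) =
      ∑ i ∈ s, v i - s.card.choose 2 := by
  induction s using Finset.induction_on with
  | empty => simp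
  | insert a s ha ih =>
    have hai : ∀ i ∈ s, v a ≠ v i := fun i hi h => ha (hv h ▸ hi)
    have hpf := prod_sub_one_div_eq_one_sub_sum hv s (v a) hai
    have key : ∀ i ∈ s, ∏ j ∈ (insert a s).erase i, (v i - 1 - v j) / (v i - v j) =
        (∏ j ∈ s.erase i, (v i - 1 - v j) / (v i - v j))
          + (∏ j ∈ s.erase i, (v i - 1 - v j) / (v i - v j)) / (v a - v i) := by
      intro i hi
      have hia : a ≠ i := fun h => ha (h ▸ hi)
      have h2 : v i - v a ≠ 0 := sub_ne_zero.2 (hai i hi).symm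
      have h4 : v a - v i = -(v i - v a) := by ring
      rw [Finset.erase_insert_of_ne hia, Finset.prod_insert (by simp [ha]), h4]
      field_simp
      ring
    have key' : ∀ i ∈ s, v i * ∏ j ∈ (insert a s).erase i, (v i - 1 - v j) / (v i - v j) =
        v i * (∏ j ∈ s.erase i, (v i - 1 - v j) / (v i - v j))
          - (∏ j ∈ s.erase i, (v i - 1 - v j) / (v i - v j))
          + v a * ((∏ j ∈ s.erase i, (v i - 1 - v j) / (v i - v j)) / (v a - v i)) := by
      intro i hi
      have h3 : v a - v i ≠ 0 := sub_ne_zero.2 (hai i hi)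
      rw [key i hi]
      field_simp
      ring
    rw [Finset.sum_insert ha, Finset.sum_insert ha, Finset.sum_insert ha,
      Finset.erase_insert ha, Finset.card_insert_of_notMem ha, hpf,
      Finset.sum_congr rfl key, Finset.sum_congr rfl key', Finset.sum_add_distrib,
      Finset.sum_add_distrib, Finset.sum_sub_distrib, ih.1, ih.2, ← Finset.mul_sum,
      Nat.choose_succ_succ, Nat.choose_one_right]
    push_cast
    constructor <;> ring

/-- The Vandermonde product `∏_{a < b} (l a - l b)`. -/
def vandermondeProd {m : ℕ} (l : Fin m → ℝ) : ℝ := ∏ a, ∏ b ∈ Finset.Ioi a, (l a - l b)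

theorem vandermondeProd_update {m : ℕ} {l : Fin m → ℝ} (hl : Function.Injective l) (i : Fin m)
    (z : ℝ) : vandermondeProd (Function.update l i z) =
      vandermondeProd l * ∏ j ∈ Finset.univ.erase i, (z - l j) / (l i - l j) := by
  set r : Fin m → ℝ := fun j => (z - l j) / (l i - l j) with hr
  have hfac : ∀ a, ∀ b ∈ Finset.Ioi a,
      Function.update l i z a - Function.update l i z b =
        (l a - l b) * ((if a = i then r b else 1) * (if b = i then r a else 1)) := by
    intro a b hab
    have hab : a < b := by simpa using hab
    have hne : l a - l b ≠ 0 := sub_ne_zero.2 fun h => hab.ne (hl h)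
    by_cases ha : a = i
    · subst ha
      simp only [Function.update_self, Function.update_of_ne hab.ne', if_true, if_neg hab.ne', hr]
      field_simp
    · by_cases hb : b = i
      · subst hb
        have hne' : l b - l a ≠ 0 := sub_ne_zero.2 fun h => hab.ne (hl h).symm
        simp only [Function.update_self, Function.update_of_ne ha, if_true, if_neg ha, hr]
        field_simp
        ring
      · simp [ha, hb]
  have hsplit : (Finset.univ : Finset (Fin m)).erase i = Finset.Ioi i ∪ Finset.Iio i := by
    ext j
    simp only [Finset.mem_erase, Finset.mem_univ, and_true, Finset.mem_union, Finset.mem_Ioi,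
      Finset.mem_Iio]
    exact ⟨fun h => (lt_or_gt_of_ne h).symm, fun h => h.elim ne_of_gt ne_of_lt⟩
  have hdisj : Disjoint (Finset.Ioi i) (Finset.Iio i) := by
    rw [Finset.disjoint_left]
    intro j h1 h2
    exact absurd (Finset.mem_Ioi.1 h1) (Finset.mem_Iio.1 h2).asymm
  unfold vandermondeProd
  rw [Finset.prod_congr rfl fun a _ => Finset.prod_congr rfl (hfac a), hsplit,
    Finset.prod_union hdisj]
  simp only [Finset.prod_mul_distrib]
  congr 1
  congr 1
  · rw [Finset.prod_eq_single i]
    · simp [hr]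
    · intro a _ ha
      simp [ha]
    · simp
  · have : ∀ a, (∏ b ∈ Finset.Ioi a, if b = i then r a else 1) = if a < i then r a else 1 := by
      intro a
      rw [Finset.prod_ite_eq']
      simp
    simp only [this]
    rw [← Finset.prod_filter]
    congr 1
    ext; simp

/-! ### Tableaux of arbitrary shape -/

/-- `E` is a standard Young tableau of shape `lam` (row `i` has the cells `(i, j)`, `j < lam i`),
extended by zero outside of the shape. -/
structure IsTableau {m : ℕ} (lam : Fin m → ℕ) (E : Fin m → ℕ → ℕ) : Prop where
  zero : ∀ i j, lam i ≤ j → E i j = 0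
  pos : ∀ i j, j < lam i → 0 < E i j
  le : ∀ i j, E i j ≤ ∑ i, lam i
  inj : ∀ i j i' j', j < lam i → j' < lam i' → E i j = E i' j' → i = i' ∧ j = j'
  row : ∀ i j j', j < j' → j' < lam i → E i j < E i j'
  col : ∀ i i' j, i < i' → j < lam i' → E i j < E i' j

/-- Put the entry `N` into the cell `(i, k)`. -/
def insertEntry {m : ℕ} (i : Fin m) (k N : ℕ) (E : Fin m → ℕ → ℕ) : Fin m → ℕ → ℕ :=
  fun a j => if a = i ∧ j = k then N else E a j

theorem IsTableau.insertEntry {m : ℕ} {lam : Fin m → ℕ} {i : Fin m} (hi : 0 < lam i)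
    {E : Fin m → ℕ → ℕ} (hanti : Antitone (Function.update lam i (lam i - 1)))
    (hE : IsTableau (Function.update lam i (lam i - 1)) E) :
    IsTableau lam (insertEntry i (lam i - 1) (∑ i, lam i) E) := by
  have hsum : ∑ a, Function.update lam i (lam i - 1) a + 1 = ∑ a, lam a := by
    rw [Finset.sum_update_of_mem (Finset.mem_univ i),
      ← Finset.add_sum_erase Finset.univ lam (Finset.mem_univ i), ← Finset.erase_eq]
    omega
  have hlt : ∀ a j, E a j < ∑ i, lam i := fun a j => by have := hE.le a j; omega
  have hup : ∀ a, Function.update lam i (lam i - 1) a = if a = i then lam i - 1 else lam a := by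
    intro a; simp [Function.update_apply]
  have hshape : ∀ a j, j < lam a → ¬ (a = i ∧ j = lam i - 1) →
      j < Function.update lam i (lam i - 1) a := by
    intro a j hj hn
    rw [hup]; split_ifs with h
    · subst h; have : j ≠ lam a - 1 := fun h => hn ⟨rfl, h⟩
      omega
    · exact hj
  refine ⟨?_, ?_, ?_, ?_, ?_, ?_⟩
  · intro a j h
    have hn : ¬ (a = i ∧ j = lam i - 1) := by rintro ⟨rfl, h'⟩; omega
    simp only [_root_.insertEntry, if_neg hn]
    apply hE.zero
    rw [hup]; split_ifs with h' <;> [(subst h'; omega); exact h]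
  · intro a j h
    unfold _root_.insertEntry
    split_ifs with hc
    · omega
    · exact hE.pos a j (hshape a j h hc)
  · intro a j
    unfold _root_.insertEntry
    split_ifs with hc
    · exact le_rfl
    · exact (hlt a j).le
  · intro a j a' j' h h' heq
    unfold _root_.insertEntry at heq
    split_ifs at heq with h1 h2 h2
    · exact ⟨h1.1.trans h2.1.symm, h1.2.trans h2.2.symm⟩
    · have := hlt a' j'; omega
    · have := hlt a j; omega
    · exact hE.inj a j a' j' (hshape a j h h1) (hshape a' j' h' h2) heq
  · intro a j j' hj h
    unfold _root_.insertEntry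
    have h1 : ¬ (a = i ∧ j = lam i - 1) := by rintro ⟨rfl, h'⟩; omega
    rw [if_neg h1]
    split_ifs with h2
    · exact hlt a j
    · exact hE.row a j j' hj (hshape a j' h h2)
  · intro a a' j ha h
    unfold _root_.insertEntry
    by_cases h2 : a' = i ∧ j = lam i - 1
    · have h1 : ¬ (a = i ∧ j = lam i - 1) := by rintro ⟨rfl, h'⟩; exact ha.ne h2.1.symm
      rw [if_neg h1, if_pos h2]
      exact hlt a j
    · have h3 := hshape a' j h h2
      rw [if_neg h2]
      by_cases h1 : a = i ∧ j = lam i - 1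
      · obtain ⟨rfl, rfl⟩ := h1
        have := hanti ha.le
        rw [hup, hup, if_neg ha.ne', if_pos rfl] at this
        omega
      · rw [if_neg h1]
        exact hE.col a a' j ha h3

/-- The row lengths of a shape, shifted to `lam i + (m - 1 - i)`: strictly decreasing in `i` when
`lam` is antitone. -/
def shiftedRow {m : ℕ} (lam : Fin m → ℕ) (i : Fin m) : ℕ := lam i + (m - 1 - i)

theorem shiftedRow_strictAnti {m : ℕ} {lam : Fin m → ℕ} (h : Antitone lam) :
    StrictAnti (shiftedRow lam) := by
  intro i j hij
  have h1 := h hij.le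
  have h2 : (i : ℕ) < j := hij
  have h3 := j.isLt
  unfold shiftedRow
  omega

/-- Frobenius' expression for the number of standard Young tableaux of a given shape. -/
noncomputable def frobeniusCount {m : ℕ} (lam : Fin m → ℕ) : ℝ :=
  (∑ i, lam i).factorial * vandermondeProd (fun i => (shiftedRow lam i : ℝ)) /
    ∏ i, ((shiftedRow lam i).factorial : ℝ)

theorem sum_shiftedRow {m : ℕ} (lam : Fin m → ℕ) :
    ∑ i, shiftedRow lam i = ∑ i, lam i + m.choose 2 := by
  unfold shiftedRow
  rw [Finset.sum_add_distrib, Fin.sum_univ_eq_sum_range (fun i => m - 1 - i) m,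
    Finset.sum_range_reflect (fun i => i) m, Finset.sum_range_id, Nat.choose_two_right]

/-- For the empty shape the Vandermonde product is the product of the factorials of
`0, …, m - 1`. -/
theorem frobeniusCount_zero {m : ℕ} : frobeniusCount (fun _ : Fin m => 0) = 1 := by
  have hv : vandermondeProd (fun i : Fin m => (shiftedRow (fun _ => 0) i : ℝ)) =
      ∏ i, ((shiftedRow (fun _ : Fin m => 0) i).factorial : ℝ) := by
    unfold vandermondeProd
    refine Finset.prod_congr rfl fun a _ => ?_
    have ha := a.isLt
    have h1 : ∏ b ∈ Finset.Ioi a, (((shiftedRow (fun _ : Fin m => 0) a : ℕ) : ℝ) -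
        (shiftedRow (fun _ : Fin m => 0) b : ℕ)) =
        ∏ b ∈ Finset.Ioi a, (((b : ℕ) - (a : ℕ) : ℕ) : ℝ) := by
      refine Finset.prod_congr rfl fun b hb => ?_
      have hab : a < b := Finset.mem_Ioi.1 hb
      have hab : (a : ℕ) < b := hab
      have hb := b.isLt
      rw [← Nat.cast_sub]
      · congr 1
        simp only [shiftedRow]
        omega
      · simp only [shiftedRow]
        omega
    rw [h1]
    have h2 : ∏ b ∈ Finset.Ioi a, (((b : ℕ) - (a : ℕ) : ℕ) : ℝ) =
        ∏ k ∈ Finset.Ioo (a : ℕ) m, ((k - (a : ℕ) : ℕ) : ℝ) := by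
      rw [← Fin.map_valEmbedding_Ioi, Finset.prod_map]
      rfl
    rw [h2]
    have h3 : shiftedRow (fun _ : Fin m => 0) a = m - 1 - a := by simp [shiftedRow]
    rw [h3, ← Finset.prod_range_add_one_eq_factorial]
    push_cast
    symm
    refine Finset.prod_bij (fun k _ => k + a + 1) ?_ ?_ ?_ ?_
    · intro k hk; simp only [Finset.mem_range, Finset.mem_Ioo] at hk ⊢; omega
    · intro k _ k' _ h; simpa using h
    · intro k hk
      simp only [Finset.mem_Ioo] at hk
      exact ⟨k - a - 1, by simp only [Finset.mem_range]; omega, by omega⟩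
    · intro k _
      have : k + a + 1 - a = k + 1 := by omega
      rw [this]; push_cast; ring
  unfold frobeniusCount
  rw [hv]
  simp only [Finset.sum_const_zero, Nat.factorial_zero, Nat.cast_one, one_mul]
  exact div_self (Finset.prod_ne_zero_iff.2 fun i _ => by positivity)

/-- The contribution of row `i` to the sum in `sum_prod_sub_one_div`. By `frobeniusCount_update`,
its quotient by the size of the shape is the proportion that Frobenius' formula gives for the
tableaux with their largest entry in row `i`. -/
noncomputable def rowWeight {m : ℕ} (lam : Fin m → ℕ) (i : Fin m) : ℝ :=
  (shiftedRow lam i : ℝ) * ∏ j ∈ Finset.univ.erase i,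
    ((shiftedRow lam i : ℝ) - 1 - shiftedRow lam j) / ((shiftedRow lam i : ℝ) - shiftedRow lam j)

theorem sum_rowWeight {m : ℕ} {lam : Fin m → ℕ} (h : Antitone lam) :
    ∑ i, rowWeight lam i = ((∑ i, lam i : ℕ) : ℝ) := by
  have hinj : Function.Injective fun i => (shiftedRow lam i : ℝ) :=
    Nat.cast_injective.comp (shiftedRow_strictAnti h).injective
  have := (sum_prod_sub_one_div hinj Finset.univ).2
  unfold rowWeight
  rw [this, ← Nat.cast_sum, sum_shiftedRow, Finset.card_univ, Fintype.card_fin]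
  push_cast
  ring

theorem frobeniusCount_update {m : ℕ} {lam : Fin m → ℕ} (h : Antitone lam) {i : Fin m}
    (hi : 0 < lam i) : frobeniusCount (Function.update lam i (lam i - 1)) * (∑ i, lam i : ℕ) =
      frobeniusCount lam * rowWeight lam i := by
  have hinj : Function.Injective fun i => (shiftedRow lam i : ℝ) :=
    Nat.cast_injective.comp (shiftedRow_strictAnti h).injective
  have hsum : ∑ a, lam a = ∑ a, Function.update lam i (lam i - 1) a + 1 := by
    rw [Finset.sum_update_of_mem (Finset.mem_univ i),
      ← Finset.add_sum_erase Finset.univ lam (Finset.mem_univ i), ← Finset.erase_eq]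
    omega
  have hsh : shiftedRow (Function.update lam i (lam i - 1)) =
      Function.update (shiftedRow lam) i (shiftedRow lam i - 1) := by
    ext a
    by_cases ha : a = i
    · subst ha; simp [shiftedRow]; omega
    · simp [shiftedRow, ha]
  have hpos : 1 ≤ shiftedRow lam i := by unfold shiftedRow; omega
  have hcast : (fun a => (shiftedRow (Function.update lam i (lam i - 1)) a : ℝ)) =
      Function.update (fun a => (shiftedRow lam a : ℝ)) i ((shiftedRow lam i : ℝ) - 1) := by
    ext a
    rw [hsh]
    by_cases ha : a = i
    · subst ha; simp [Nat.cast_sub hpos]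
    · simp [ha]
  have hprod : ∏ a, ((shiftedRow lam a).factorial : ℝ) = shiftedRow lam i *
      ∏ a, ((shiftedRow (Function.update lam i (lam i - 1)) a).factorial : ℝ) := by
    rw [← Finset.mul_prod_erase Finset.univ _ (Finset.mem_univ i),
      ← Finset.mul_prod_erase Finset.univ (fun a =>
        ((shiftedRow (Function.update lam i (lam i - 1)) a).factorial : ℝ)) (Finset.mem_univ i),
      ← mul_assoc]
    congr 1
    · rw [hsh, Function.update_self]
      exact_mod_cast (Nat.mul_factorial_pred (by omega)).symm
    · refine Finset.prod_congr rfl fun a ha => ?_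
      rw [hsh, Function.update_of_ne (Finset.ne_of_mem_erase ha)]
  have hP : ∏ a, ((shiftedRow (Function.update lam i (lam i - 1)) a).factorial : ℝ) ≠ 0 :=
    Finset.prod_ne_zero_iff.2 fun i _ => by positivity
  have hs0 : (shiftedRow lam i : ℝ) ≠ 0 := by
    have : shiftedRow lam i ≠ 0 := by omega
    exact_mod_cast this
  unfold frobeniusCount rowWeight
  rw [hcast, vandermondeProd_update hinj, hprod, hsum, Nat.factorial_succ]
  push_cast
  field_simp

/-- A row whose last cell cannot be removed has weight zero, so that the sum in `sum_rowWeight` runs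
over the corners of the shape. -/
theorem rowWeight_eq_zero_or_corner {m : ℕ} {lam : Fin m → ℕ} (h : Antitone lam) (i : Fin m) :
    rowWeight lam i = 0 ∨ (0 < lam i ∧ Antitone (Function.update lam i (lam i - 1))) := by
  have hi := i.isLt
  by_cases hc : ∃ k : Fin m, (k : ℕ) = i + 1 ∧ lam k = lam i
  · -- the row below has the same length, so the factor with `j = i + 1` vanishes
    obtain ⟨k, hk, hlk⟩ := hc
    left
    unfold rowWeight
    refine mul_eq_zero_of_right _ (Finset.prod_eq_zero (i := k) ?_ ?_)
    · simp only [Finset.mem_erase, Finset.mem_univ, and_true]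
      rintro rfl; omega
    · have : shiftedRow lam i = shiftedRow lam k + 1 := by
        have := k.isLt
        unfold shiftedRow; omega
      rw [this]; simp
  · push Not at hc
    by_cases h0 : 0 < lam i
    · refine Or.inr ⟨h0, fun a b hab => ?_⟩
      rcases eq_or_ne b i with rfl | hb
      · rw [Function.update_self]
        rcases eq_or_ne a b with rfl | ha
        · simp
        · rw [Function.update_of_ne ha]
          have := h hab; omega
      · rw [Function.update_of_ne hb]
        rcases eq_or_ne a i with rfl | ha
        · rw [Function.update_self]
          have hlt : (a : ℕ) < b := lt_of_le_of_ne hab fun h => hb (Fin.ext h.symm)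
          have hb' := b.isLt
          have h1 := hc ⟨a + 1, by omega⟩ rfl
          have h2 : lam ⟨a + 1, by omega⟩ ≤ lam a := h (Fin.le_def.2 (by simp))
          have h3 : lam b ≤ lam ⟨a + 1, by omega⟩ := h (Fin.le_def.2 (by simp; omega))
          omega
        · rw [Function.update_of_ne ha]
          exact h hab
    · left
      have hlast : m - 1 - (i : ℕ) = 0 := by
        by_contra hne
        have h2 : lam ⟨i + 1, by omega⟩ ≤ lam i := h (Fin.le_def.2 (by simp))
        exact hc ⟨i + 1, by omega⟩ rfl (by omega)
      have : shiftedRow lam i = 0 := by unfold shiftedRow; omega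
      unfold rowWeight
      rw [this]; simp

/-- Removing the cell of the largest entry shows that the number of tableaux dominates every
function with the recursion of Frobenius' expression. -/
theorem exists_finset_isTableau {m : ℕ} (N : ℕ) : ∀ lam : Fin m → ℕ, ∑ i, lam i = N →
    Antitone lam → ∃ s : Finset (Fin m → ℕ → ℕ),
      (∀ E ∈ s, IsTableau lam E) ∧ frobeniusCount lam ≤ s.card := by
  classical
  induction N with
  | zero =>
    intro lam hN _
    have h0 : lam = fun _ => 0 := by
      ext i; exact Finset.sum_eq_zero_iff.1 hN i (Finset.mem_univ i)
    subst h0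
    refine ⟨{fun _ _ => 0}, ?_, by rw [frobeniusCount_zero]; simp⟩
    intro E hE
    rw [Finset.mem_singleton] at hE
    subst hE
    constructor <;> simp
  | succ N ih =>
    intro lam hN hlam
    have hsum : ∀ i, 0 < lam i → ∑ a, Function.update lam i (lam i - 1) a = N := by
      intro i hi
      rw [Finset.sum_update_of_mem (Finset.mem_univ i), ← Finset.erase_eq]
      rw [← Finset.add_sum_erase Finset.univ lam (Finset.mem_univ i)] at hN
      omega
    have hex : ∀ i, ∃ s : Finset (Fin m → ℕ → ℕ), (∀ E ∈ s, IsTableau lam E ∧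
        E i (lam i - 1) = N + 1 ∧ 0 < lam i) ∧
        frobeniusCount lam * rowWeight lam i ≤ s.card * (N + 1 : ℕ) := by
      intro i
      rcases rowWeight_eq_zero_or_corner hlam i with h | ⟨hpos, hanti⟩
      · exact ⟨∅, by simp, by simp [h]⟩
      · obtain ⟨s, hs, hcard⟩ := ih _ (hsum i hpos) hanti
        refine ⟨s.image (insertEntry i (lam i - 1) (N + 1)), ?_, ?_⟩
        · intro E hE
          obtain ⟨E', hE', rfl⟩ := Finset.mem_image.1 hE
          refine ⟨?_, by simp [insertEntry], hpos⟩
          rw [← hN]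
          exact (hs E' hE').insertEntry hpos hanti
        · rw [Finset.card_image_of_injOn, ← frobeniusCount_update hlam hpos, hN]
          · gcongr
          · intro E hE E' hE' heq
            ext a j
            by_cases hc : a = i ∧ j = lam i - 1
            · obtain ⟨rfl, rfl⟩ := hc
              rw [(hs E hE).zero _ _ (by simp), (hs E' hE').zero _ _ (by simp)]
            · have := congrFun (congrFun heq a) j
              simpa only [insertEntry, if_neg hc] using this
    choose s hs hcard using hex
    refine ⟨Finset.univ.biUnion s, ?_, ?_⟩
    · intro E hE
      obtain ⟨i, -, hi⟩ := Finset.mem_biUnion.1 hE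
      exact (hs i E hi).1
    · rw [Finset.card_biUnion]
      · have h1 := Finset.sum_le_sum fun i (_ : i ∈ Finset.univ) => hcard i
        rw [← Finset.mul_sum, sum_rowWeight hlam, hN, ← Finset.sum_mul] at h1
        push_cast at h1 ⊢
        exact le_of_mul_le_mul_right h1 (by positivity)
      · intro i _ k _ hik
        rw [Function.onFun, Finset.disjoint_left]
        intro E h1 h2
        obtain ⟨hT, e1, p1⟩ := hs i E h1
        obtain ⟨-, e2, p2⟩ := hs k E h2
        exact hik (hT.inj i _ k _ (by omega) (by omega) (e1.trans e2.symm)).1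

/-- A tableau of the rectangular shape `m × n` as an element of `RectSYT m n`. -/
def IsTableau.toRectSYT {m n : ℕ} {E : Fin m → ℕ → ℕ} (hE : IsTableau (fun _ : Fin m => n) E) :
    RectSYT m n where
  entry i j := E i j
  bijOn := by
    have hinj : Function.Injective (fun p : Fin m × Fin n => E p.1 p.2) := by
      intro p q h
      obtain ⟨h1, h2⟩ := hE.inj _ _ _ _ p.2.isLt q.2.isLt h
      exact Prod.ext h1 (Fin.ext h2)
    have hmaps : ∀ p : Fin m × Fin n, E p.1 p.2 ∈ Finset.Icc 1 (m * n) := by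
      intro p
      rw [Finset.mem_Icc]
      exact ⟨hE.pos _ _ p.2.isLt, by simpa using hE.le p.1 p.2⟩
    have himg : Finset.univ.image (fun p : Fin m × Fin n => E p.1 p.2) = Finset.Icc 1 (m * n) := by
      apply Finset.eq_of_subset_of_card_le
      · intro k hk
        obtain ⟨p, -, rfl⟩ := Finset.mem_image.1 hk
        exact hmaps p
      · rw [Finset.card_image_of_injective _ hinj]
        simp
    have h := hinj.injOn (s := Set.univ) |>.bijOn_image
    rwa [← Finset.coe_univ, ← Finset.coe_image, himg, Finset.coe_Icc, Finset.coe_univ] at h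
  row_strictMono i j l h := hE.row _ _ _ h l.isLt
  col_strictMono j i k h := hE.col _ _ _ h j.isLt

theorem frobeniusCount_le_card_rectSYT (m n : ℕ) :
    frobeniusCount (fun _ : Fin m => n) ≤ Nat.card (RectSYT m n) := by
  classical
  obtain ⟨s, hs, hcard⟩ := exists_finset_isTableau _ (fun _ : Fin m => n) rfl antitone_const
  refine hcard.trans ?_
  have hinj : Function.Injective fun E : s => (hs E.1 E.2).toRectSYT := by
    intro E E' h
    ext i j
    by_cases hj : j < n
    · exact congrFun (congrFun (congrArg RectSYT.entry h) i) ⟨j, hj⟩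
    · rw [(hs E.1 E.2).zero i j (by omega), (hs E'.1 E'.2).zero i j (by omega)]
  have := Nat.card_le_card_of_injective _ hinj
  rw [Nat.card_eq_fintype_card, Fintype.card_coe] at this
  exact_mod_cast this

/-- The hook length formula for rectangles, as a lower bound and in the form of a product over the
rows. -/
theorem factorial_mul_prod_le_card_rectSYT_mul (m n : ℕ) :
    ((m * n).factorial : ℝ) * ∏ i ∈ Finset.range m, (i.factorial : ℝ) ≤
      Nat.card (RectSYT m n) * ∏ i ∈ Finset.range m, ((n + i).factorial : ℝ) := by
  have h := frobeniusCount_le_card_rectSYT m n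
  have hz := frobeniusCount_zero (m := m)
  have key : ∀ k, ∏ i : Fin m, ((shiftedRow (fun _ : Fin m => k) i).factorial : ℝ) =
      ∏ i ∈ Finset.range m, ((k + i).factorial : ℝ) := by
    intro k
    unfold shiftedRow
    rw [Fin.prod_univ_eq_prod_range (fun i => ((k + (m - 1 - i)).factorial : ℝ)) m,
      Finset.prod_range_reflect (fun i => ((k + i).factorial : ℝ)) m]
  have hv : ∀ k, vandermondeProd (fun i => (shiftedRow (fun _ : Fin m => k) i : ℝ)) =
      vandermondeProd (fun i => (shiftedRow (fun _ : Fin m => 0) i : ℝ)) := by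
    intro k
    simp [vandermondeProd, shiftedRow]
  have hpos : ∀ k, 0 < ∏ i ∈ Finset.range m, ((k + i).factorial : ℝ) :=
    fun k => Finset.prod_pos fun i _ => by positivity
  unfold frobeniusCount at h hz
  rw [key, div_eq_one_iff_eq (hpos 0).ne'] at hz
  simp only [Finset.sum_const_zero, Nat.factorial_zero, Nat.cast_one, one_mul, zero_add] at hz
  rw [key, hv, hz, div_le_iff₀ (hpos n)] at h
  simpa using h

/-- A lower bound for the hook length product of a rectangle, by induction on `n`: passing from `n`
to `n + 1`, the product grows by the factor
`∏_{i < m} (m n + 1 + i) / (n + 1 + i) ≥ (m (n + 1) / (n + m)) ^ m`. -/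
theorem pow_mul_prod_factorial_le {m : ℕ} (hm : 1 ≤ m) (n : ℕ) :
    m ^ (m * n) * ∏ i ∈ Finset.range m, (n + i).factorial ≤
      (m * n).factorial * (∏ i ∈ Finset.range m, i.factorial) * (n + m - 1).choose n ^ m := by
  induction n with
  | zero => simp
  | succ n ih =>
    have h1 : ∏ i ∈ Finset.range m, (n + 1 + i).factorial =
        (∏ i ∈ Finset.range m, (n + 1 + i)) * ∏ i ∈ Finset.range m, (n + i).factorial := by
      rw [← Finset.prod_mul_distrib]
      refine Finset.prod_congr rfl fun i _ => ?_
      rw [show n + 1 + i = n + i + 1 by ring, Nat.factorial_succ]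
    have h2 : (m * (n + 1)).factorial =
        (m * n).factorial * ∏ i ∈ Finset.range m, (m * n + 1 + i) := by
      rw [← Nat.ascFactorial_eq_prod_range, Nat.factorial_mul_ascFactorial]
      rfl
    have h3 : (n + 1) * (n + 1 + m - 1).choose (n + 1) = (n + m) * (n + m - 1).choose n := by
      have := Nat.add_one_mul_choose_eq (n + m - 1) n
      rw [show n + m - 1 + 1 = n + m by omega] at this
      rw [show n + 1 + m - 1 = n + m by omega, this, mul_comm]
    have h4 : (m * (n + 1)) ^ m * ∏ i ∈ Finset.range m, (n + 1 + i) ≤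
        (∏ i ∈ Finset.range m, (m * n + 1 + i)) * (n + m) ^ m := by
      have hc : ∀ a : ℕ, a ^ m = ∏ i ∈ Finset.range m, a := by simp
      rw [hc, hc, ← Finset.prod_mul_distrib, ← Finset.prod_mul_distrib]
      refine Finset.prod_le_prod' fun i hi => ?_
      obtain ⟨u, rfl⟩ := Nat.exists_eq_add_of_lt (Finset.mem_range.1 hi)
      nlinarith [Nat.zero_le (u * n * (i + u))]
    have hpos : 0 < (n + 1) ^ m := by positivity
    refine Nat.le_of_mul_le_mul_left ?_ hpos
    calc (n + 1) ^ m * (m ^ (m * (n + 1)) * ∏ i ∈ Finset.range m, (n + 1 + i).factorial)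
        = (m ^ (m * n) * ∏ i ∈ Finset.range m, (n + i).factorial) *
          ((m * (n + 1)) ^ m * ∏ i ∈ Finset.range m, (n + 1 + i)) := by
          rw [h1, mul_pow m, show m ^ (m * (n + 1)) = m ^ (m * n) * m ^ m from pow_add _ _ _]
          ring
      _ ≤ ((m * n).factorial * (∏ i ∈ Finset.range m, i.factorial) *
          (n + m - 1).choose n ^ m) *
          ((∏ i ∈ Finset.range m, (m * n + 1 + i)) * (n + m) ^ m) := Nat.mul_le_mul ih h4
      _ = (m * n).factorial * (∏ i ∈ Finset.range m, (m * n + 1 + i)) *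
          (∏ i ∈ Finset.range m, i.factorial) * ((n + m) * (n + m - 1).choose n) ^ m := by
          rw [mul_pow]; ring
      _ = _ := by rw [h2, ← h3, mul_pow]; ring

theorem pow_le_card_rectSYT_mul {m : ℕ} (hm : 1 ≤ m) (n : ℕ) :
    m ^ (m * n) ≤ Nat.card (RectSYT m n) * (n + m - 1).choose n ^ m := by
  have h1 : (m * n).factorial * ∏ i ∈ Finset.range m, i.factorial ≤
      Nat.card (RectSYT m n) * ∏ i ∈ Finset.range m, (n + i).factorial := by
    exact_mod_cast factorial_mul_prod_le_card_rectSYT_mul m n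
  have h2 := pow_mul_prod_factorial_le hm n
  have hpos : 0 < ∏ i ∈ Finset.range m, (n + i).factorial :=
    Finset.prod_pos fun i _ => Nat.factorial_pos _
  refine Nat.le_of_mul_le_mul_right ?_ hpos
  calc _ ≤ _ := h2
    _ ≤ _ := Nat.mul_le_mul_right _ h1
    _ = _ := by ring

/-! ### Sign patterns of linear forms -/

/-- A family of sign patterns of linear forms on a space of dimension `d`, all taken at points where
no form vanishes, has VC dimension at most `d`: a linear relation among the forms of a shattered
set excludes the sign pattern of its own coefficients. -/
theorem vcDim_le_finrank {α V : Type*} [Fintype α] [DecidableEq α] [AddCommGroup V] [Module ℝ V]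
    [FiniteDimensional ℝ V] (f : α → Module.Dual ℝ V) (𝒜 : Finset (Finset α))
    (h𝒜 : ∀ u ∈ 𝒜, ∃ v : V, (∀ a, f a v ≠ 0) ∧ ∀ a, a ∈ u ↔ 0 < f a v) :
    𝒜.vcDim ≤ Module.finrank ℝ V := by
  refine Finset.sup_le fun s hs => ?_
  rw [Finset.mem_shatterer] at hs
  have hli : LinearIndependent ℝ fun a : s => f a := by
    by_contra hdep
    obtain ⟨c, hc, a₀, ha₀⟩ := Fintype.not_linearIndependent_iff.1 hdep
    obtain ⟨u, hu, hsu⟩ := hs (t := s.filter fun a => ∃ h : a ∈ s, 0 < c ⟨a, h⟩)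
      (Finset.filter_subset _ _)
    obtain ⟨v, hv0, hv⟩ := h𝒜 u hu
    have hsign : ∀ a : s, 0 < f a v ↔ 0 < c a := by
      intro a
      rw [← hv]
      have := Finset.ext_iff.1 hsu a
      simpa using this
    have hsum : ∑ a, c a * f a v = 0 := by
      simpa using LinearMap.congr_fun hc v
    have hnn : ∀ a ∈ Finset.univ, 0 ≤ c a * f a v := by
      intro a _
      by_cases h : 0 < c a
      · exact (mul_pos h ((hsign a).2 h)).le
      · exact mul_nonneg_of_nonpos_of_nonpos (not_lt.1 h) (not_lt.1 fun h' => h ((hsign a).1 h'))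
    have := (Finset.sum_eq_zero_iff_of_nonneg hnn).1 hsum a₀ (Finset.mem_univ _)
    exact (mul_ne_zero ha₀ (hv0 a₀)) this
  have := hli.fintype_card_le_finrank
  rwa [Fintype.card_coe, Subspace.dual_finrank_eq] at this

theorem card_signPatterns_le {α V : Type*} [Fintype α] [DecidableEq α] [AddCommGroup V]
    [Module ℝ V] [FiniteDimensional ℝ V] (f : α → Module.Dual ℝ V) (𝒜 : Finset (Finset α))
    (h𝒜 : ∀ u ∈ 𝒜, ∃ v : V, (∀ a, f a v ≠ 0) ∧ ∀ a, a ∈ u ↔ 0 < f a v) :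
    𝒜.card ≤ ∑ k ∈ Finset.Iic (Module.finrank ℝ V), (Fintype.card α).choose k :=
  (Finset.card_le_card_shatterer 𝒜).trans <| Finset.card_shatterer_le_sum_vcDim.trans <|
    Finset.sum_le_sum_of_subset (Finset.Iic_subset_Iic.2 (vcDim_le_finrank f 𝒜 h𝒜))

/-! ### Realizable tableaux -/

/-- The comparisons of sums `x i + y j` that involve two distinct columns `l < j`: either inside
one row (`none`), or between two distinct rows. -/
abbrev Comparison (m n : ℕ) : Type :=
  Option {p : Fin m × Fin m // p.1 ≠ p.2} × {p : Fin n × Fin n // p.1 < p.2}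

theorem card_comparison (m n : ℕ) :
    Fintype.card (Comparison m n) = (m * (m - 1) + 1) * n.choose 2 := by
  have h1 : Fintype.card {p : Fin m × Fin m // p.1 ≠ p.2} = m * (m - 1) := by
    have : Fintype.card {p : Fin m × Fin m // p.1 ≠ p.2} =
        (Finset.univ : Finset (Fin m)).offDiag.card := by
      rw [Fintype.card_subtype]; congr 1; ext p; simp
    rw [this, Finset.offDiag_card, Finset.card_univ, Fintype.card_fin, Nat.mul_sub, mul_one]
  have h2 : Fintype.card {p : Fin n × Fin n // p.1 < p.2} = n.choose 2 := by
    have e : {p : Fin n × Fin n // p.1 < p.2} ≃ (Σ j : Fin n, Fin j) :=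
      { toFun := fun p => ⟨p.1.2, ⟨p.1.1, p.2⟩⟩
        invFun := fun q => ⟨(⟨q.2, q.2.isLt.trans q.1.isLt⟩, q.1), q.2.isLt⟩
        left_inv := fun p => rfl
        right_inv := fun q => rfl }
    rw [Fintype.card_congr e, Fintype.card_sigma]
    simp only [Fintype.card_fin]
    rw [Fin.sum_univ_eq_sum_range (fun i => i) n, Finset.sum_range_id, Nat.choose_two_right]
  rw [Fintype.card_prod, Fintype.card_option, h1, h2]

/-- The linear form in `(x, y)` whose sign decides a comparison. -/
def comparisonForm {m n : ℕ} (c : Comparison m n) : Module.Dual ℝ ((Fin m → ℝ) × (Fin n → ℝ)) :=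
  let X (i : Fin m) : Module.Dual ℝ (Fin m → ℝ) := LinearMap.proj i
  let Y (j : Fin n) : Module.Dual ℝ (Fin n → ℝ) := LinearMap.proj j
  LinearMap.coprod (c.1.elim 0 fun p => X p.1.1 - X p.1.2) (Y c.2.1.2 - Y c.2.1.1)

theorem comparisonForm_none {m n : ℕ} (p : {p : Fin n × Fin n // p.1 < p.2}) (x : Fin m → ℝ)
    (y : Fin n → ℝ) : comparisonForm (none, p) (x, y) = y p.1.2 - y p.1.1 := by
  simp [comparisonForm]

theorem comparisonForm_some {m n : ℕ} (r : {p : Fin m × Fin m // p.1 ≠ p.2})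
    (p : {p : Fin n × Fin n // p.1 < p.2}) (x : Fin m → ℝ) (y : Fin n → ℝ) :
    comparisonForm (some r, p) (x, y) = x r.1.1 + y p.1.2 - (x r.1.2 + y p.1.1) := by
  simp [comparisonForm]; ring

theorem HasDistinctEntries.comparisonForm_ne_zero {m n : ℕ} (hm : 0 < m) {x : Fin m → ℝ}
    {y : Fin n → ℝ} (h : HasDistinctEntries (outerSum x y)) (c : Comparison m n) :
    comparisonForm c (x, y) ≠ 0 := by
  obtain ⟨o, p⟩ := c
  have hne : p.1.2 ≠ p.1.1 := p.2.ne'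
  rcases o with _ | r
  · rw [comparisonForm_none, sub_ne_zero]
    intro heq
    have := @h (⟨0, hm⟩, p.1.2) (⟨0, hm⟩, p.1.1) (by simp [outerSum, heq])
    exact hne (congrArg Prod.snd this)
  · rw [comparisonForm_some, sub_ne_zero]
    intro heq
    have := @h (r.1.1, p.1.2) (r.1.2, p.1.1) (by simpa [outerSum] using heq)
    exact hne (congrArg Prod.snd this)

/-- Two points with the same pattern of comparisons order all pairs of sums in distinct columns in
the same way. -/
theorem add_lt_add_iff_of_comparisonForm {m n : ℕ} (hm : 0 < m) {x x' : Fin m → ℝ}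
    {y y' : Fin n → ℝ} (h : HasDistinctEntries (outerSum x y))
    (h' : HasDistinctEntries (outerSum x' y'))
    (heq : ∀ c : Comparison m n, 0 < comparisonForm c (x, y) ↔ 0 < comparisonForm c (x', y'))
    (i k : Fin m) {j l : Fin n} (hjl : j ≠ l) :
    x i + y j < x k + y l ↔ x' i + y' j < x' k + y' l := by
  have hneg : ∀ c : Comparison m n,
      comparisonForm c (x, y) < 0 ↔ comparisonForm c (x', y') < 0 := by
    intro c
    have h1 := h.comparisonForm_ne_zero hm c
    have h2 := h'.comparisonForm_ne_zero hm c
    have := heq c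
    rw [← not_le, ← not_le, le_iff_lt_or_eq, le_iff_lt_or_eq, or_iff_left h1.symm,
      or_iff_left h2.symm, this]
  rcases lt_or_gt_of_ne hjl with hlt | hgt
  · by_cases hik : i = k
    · subst hik
      have := heq (none, ⟨(j, l), hlt⟩)
      rw [comparisonForm_none, comparisonForm_none, sub_pos, sub_pos] at this
      simpa using this
    · have := heq (some ⟨(k, i), fun h => hik h.symm⟩, ⟨(j, l), hlt⟩)
      rwa [comparisonForm_some, comparisonForm_some, sub_pos, sub_pos] at this
  · by_cases hik : i = k
    · subst hik
      have := hneg (none, ⟨(l, j), hgt⟩)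
      rw [comparisonForm_none, comparisonForm_none, sub_neg, sub_neg] at this
      simpa using this
    · have := hneg (some ⟨(i, k), hik⟩, ⟨(l, j), hgt⟩)
      rwa [comparisonForm_some, comparisonForm_some, sub_neg, sub_neg] at this

theorem HasDistinctEntries.comp_perm {m n : ℕ} {x : Fin m → ℝ} {y : Fin n → ℝ}
    (h : HasDistinctEntries (outerSum x y)) (σ : Equiv.Perm (Fin n)) :
    HasDistinctEntries (outerSum x (y ∘ σ)) := by
  intro p q hpq
  have := @h (p.1, σ p.2) (q.1, σ q.2) hpq
  simp only [Prod.mk.injEq, EmbeddingLike.apply_eq_iff_eq] at this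
  exact Prod.ext this.1 this.2

/-- A permuted increasing vector determines the permutation through the order of its
coordinates. -/
theorem Equiv.Perm.eq_of_comp_lt_iff {n : ℕ} {y y' : Fin n → ℝ} (hy : StrictMono y)
    (hy' : StrictMono y') {σ τ : Equiv.Perm (Fin n)}
    (h : ∀ j l, y (σ j) < y (σ l) ↔ y' (τ j) < y' (τ l)) : σ = τ := by
  have hmono : StrictMono (τ ∘ σ.symm) := by
    intro a b hab
    rw [← hy'.lt_iff_lt]
    simp only [Function.comp_apply]
    rw [← h, hy.lt_iff_lt]
    simpa using hab
  have hid : τ ∘ σ.symm = id := by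
    have : hmono.orderIsoOfSurjective _ (τ.surjective.comp σ.symm.surjective) = OrderIso.refl _ :=
      Subsingleton.elim _ _
    ext1 a
    exact DFunLike.congr_fun this a
  ext1 j
  have := congrFun hid (σ j)
  simpa using this.symm

/-- The symmetric group permutes the coordinates of `y`, so that each realizable tableau accounts
for `n!` of the sign patterns of the comparison forms. -/
theorem ncard_isRealizable_mul_factorial_le {m : ℕ} (hm : 0 < m) (n : ℕ) :
    {T : RectSYT m n | T.IsRealizable}.ncard * n.factorial ≤
      ∑ k ∈ Finset.Iic (m + n), ((m * (m - 1) + 1) * n.choose 2).choose k := by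
  classical
  have hreal : ∀ T : {T : RectSYT m n | T.IsRealizable}, ∃ (x : Fin m → ℝ) (y : Fin n → ℝ)
      (hx : StrictMono x) (hy : StrictMono y) (hxy : HasDistinctEntries (outerSum x y)),
      T.1 = outerSumTableau x y hx hy hxy := fun T => T.2
  choose x y hx hy hxy hT using hreal
  let pat : {T : RectSYT m n | T.IsRealizable} × Equiv.Perm (Fin n) → Finset (Comparison m n) :=
    fun q => Finset.univ.filter fun c => 0 < comparisonForm c (x q.1, y q.1 ∘ q.2)
  have hinj : Function.Injective pat := by
    rintro ⟨T, σ⟩ ⟨T', τ⟩ heq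
    have heq' : ∀ c : Comparison m n, 0 < comparisonForm c (x T, y T ∘ σ) ↔
        0 < comparisonForm c (x T', y T' ∘ τ) := by
      intro c
      simpa [pat] using Finset.ext_iff.1 heq c
    have hcmp := fun (i k : Fin m) (j l : Fin n) (hjl : j ≠ l) =>
      add_lt_add_iff_of_comparisonForm hm ((hxy T).comp_perm σ) ((hxy T').comp_perm τ) heq' i k hjl
    have hστ : σ = τ := by
      refine Equiv.Perm.eq_of_comp_lt_iff (hy T) (hy T') fun j l => ?_
      rcases eq_or_ne j l with rfl | hjl
      · simp
      · simpa using hcmp ⟨0, hm⟩ ⟨0, hm⟩ j l hjl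
    subst hστ
    have hlt : ∀ p q : Fin m × Fin n, x T p.1 + y T p.2 < x T q.1 + y T q.2 ↔
        x T' p.1 + y T' p.2 < x T' q.1 + y T' q.2 := by
      intro p q
      rcases eq_or_ne p.2 q.2 with hjl | hjl
      · rw [hjl, add_lt_add_iff_right, add_lt_add_iff_right, (hx T).lt_iff_lt, (hx T').lt_iff_lt]
      · have := hcmp p.1 q.1 (σ.symm p.2) (σ.symm q.2) (by simpa using hjl)
        simpa using this
    have hTT : T = T' := by
      apply Subtype.ext
      rw [hT T, hT T']
      ext i j
      change entryRank _ i j = entryRank _ i j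
      unfold entryRank
      refine congrArg Finset.card (Finset.filter_congr fun p _ => ?_)
      exact not_lt.symm.trans ((not_congr (hlt (i, j) p)).trans not_lt)
    rw [hTT]
  let _ : Fintype {T : RectSYT m n | T.IsRealizable} := Fintype.ofFinite _
  have hcard := card_signPatterns_le (comparisonForm (m := m) (n := n))
    (Finset.univ.map ⟨pat, hinj⟩) (by
      intro u hu
      obtain ⟨q, -, rfl⟩ := Finset.mem_map.1 hu
      exact ⟨(x q.1, y q.1 ∘ q.2), ((hxy q.1).comp_perm q.2).comparisonForm_ne_zero hm,
        fun c => by simp [pat]⟩)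
  rw [Finset.card_map, Finset.card_univ, Fintype.card_prod, Fintype.card_perm, Fintype.card_fin,
    card_comparison, Module.finrank_prod, Module.finrank_fin_fun, Module.finrank_fin_fun,
    ← Nat.card_eq_fintype_card, Nat.card_coe_set_eq] at hcard
  exact hcard

/-! ### Transposition -/

namespace RectSYT

/-- The transposed tableau. -/
def transpose {m n : ℕ} (T : RectSYT m n) : RectSYT n m where
  entry j i := T.entry i j
  bijOn := by
    have h := T.bijOn.comp ((Equiv.prodComm (Fin n) (Fin m)).bijective.bijOn_univ)
    rwa [mul_comm] at h
  row_strictMono j := T.col_strictMono j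
  col_strictMono i := T.row_strictMono i

theorem transpose_transpose {m n : ℕ} (T : RectSYT m n) : T.transpose.transpose = T := rfl

theorem transpose_injective {m n : ℕ} : Function.Injective (transpose (m := m) (n := n)) :=
  Function.LeftInverse.injective transpose_transpose

theorem IsRealizable.transpose {m n : ℕ} {T : RectSYT m n} (h : T.IsRealizable) :
    T.transpose.IsRealizable := by
  obtain ⟨x, y, hx, hy, hxy, rfl⟩ := h
  have hcomm : ∀ i j, outerSum y x j i = outerSum x y i j := fun i j => add_comm _ _
  refine ⟨y, x, hy, hx, ?_, ?_⟩
  · intro p q hpq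
    simp only [hcomm] at hpq
    have := @hxy (p.2, p.1) (q.2, q.1) hpq
    simp only [Prod.mk.injEq] at this
    exact Prod.ext this.2 this.1
  · ext j i
    change entryRank _ i j = entryRank _ j i
    unfold entryRank
    refine Finset.card_equiv (Equiv.prodComm _ _) fun p => ?_
    simp [hcomm]

/-- The probability that a uniformly random `m × n` tableau is realizable. -/
noncomputable def realizableProb (m n : ℕ) : ℝ :=
  {T : RectSYT m n | T.IsRealizable}.ncard / Nat.card (RectSYT m n)

theorem uniformOn_real_isRealizable (m n : ℕ) :
    (ProbabilityTheory.uniformOn (Set.univ : Set (RectSYT m n))).real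
      {T : RectSYT m n | T.IsRealizable} = realizableProb m n := by
  have : Fintype (RectSYT m n) := Fintype.ofFinite _
  rw [MeasureTheory.measureReal_def, ProbabilityTheory.uniformOn_univ,
    MeasureTheory.Measure.count_apply MeasurableSet.of_discrete, ENNReal.toReal_div,
    realizableProb, Nat.card_eq_fintype_card, ENNReal.toReal_natCast,
    ← (Set.toFinite {T : RectSYT m n | T.IsRealizable}).cast_ncard_eq, ENat.toENNReal_coe,
    ENNReal.toReal_natCast]

theorem realizableProb_comm (m n : ℕ) : realizableProb m n = realizableProb n m := by
  have h1 : ∀ m n, {T : RectSYT m n | T.IsRealizable}.ncard ≤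
      {T : RectSYT n m | T.IsRealizable}.ncard := fun m n =>
    Set.ncard_le_ncard_of_injOn transpose (fun T hT => IsRealizable.transpose hT)
      transpose_injective.injOn
  have h2 : ∀ m n, Nat.card (RectSYT m n) ≤ Nat.card (RectSYT n m) := fun m n =>
    Nat.card_le_card_of_injective _ transpose_injective
  unfold realizableProb
  rw [le_antisymm (h1 m n) (h1 n m), le_antisymm (h2 m n) (h2 n m)]

end RectSYT

/-! ### Asymptotic comparison -/

/-- Chernoff's bound for the lower tail of a row of Pascal's triangle. -/
theorem sum_choose_mul_pow_le_exp (H d : ℕ) {z : ℝ} (hz0 : 0 < z) (hz1 : z ≤ 1) :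
    ((∑ k ∈ Finset.Iic d, H.choose k : ℕ) : ℝ) * z ^ d ≤ Real.exp (z * H) := by
  calc ((∑ k ∈ Finset.Iic d, H.choose k : ℕ) : ℝ) * z ^ d
      = ∑ k ∈ Finset.Iic d, (H.choose k : ℝ) * z ^ d := by push_cast; rw [Finset.sum_mul]
    _ ≤ ∑ k ∈ Finset.Iic d, (H.choose k : ℝ) * z ^ k := by
        refine Finset.sum_le_sum fun k hk => ?_
        exact mul_le_mul_of_nonneg_left
          (pow_le_pow_of_le_one hz0.le hz1 (Finset.mem_Iic.1 hk)) (by positivity)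
    _ ≤ ∑ k ∈ Finset.range (d + H + 1), (H.choose k : ℝ) * z ^ k := by
        refine Finset.sum_le_sum_of_subset_of_nonneg ?_ fun _ _ _ => by positivity
        intro k hk
        have := Finset.mem_Iic.1 hk
        simp only [Finset.mem_range]; omega
    _ = ∑ k ∈ Finset.range (H + 1), (H.choose k : ℝ) * z ^ k := by
        symm
        refine Finset.sum_subset (Finset.range_subset_range.2 (by omega)) fun k _ hk => ?_
        rw [Nat.choose_eq_zero_of_lt (by simpa using hk)]
        simp
    _ = (z + 1) ^ H := by
        rw [add_pow]
        exact Finset.sum_congr rfl fun k _ => by ring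
    _ ≤ Real.exp z ^ H := by gcongr; exact Real.add_one_le_exp z
    _ = Real.exp (z * H) := by rw [← Real.exp_nat_mul, mul_comm]

theorem ncard_isRealizable_le {m n : ℕ} (hm : 0 < m) (hn : 2 ≤ n) :
    ({T : RectSYT m n | T.IsRealizable}.ncard : ℝ) ≤
      (Real.exp 2 * ((m * (m - 1) + 1 : ℕ) / 2)) ^ n * ((m * (m - 1) + 1 : ℕ) / 2 * n) ^ m := by
  set q : ℕ := m * (m - 1) + 1 with hq
  set R := {T : RectSYT m n | T.IsRealizable}.ncard with hR
  have hq1 : (1 : ℝ) ≤ q := by exact_mod_cast Nat.le_add_left 1 _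
  have hn2 : (2 : ℝ) ≤ n := by exact_mod_cast hn
  -- `z = Q⁻¹` is about `n / (q * n.choose 2)`, the minimizer of `z ^ (-n) * exp (z * H)` for the
  -- number `H = q * n.choose 2` of forms; the `m` further dimensions only cost the factor `Q ^ m`
  set Q : ℝ := q / 2 * n with hQ
  have hQ1 : 1 ≤ Q := by nlinarith
  have h1 : ((R * n.factorial : ℕ) : ℝ) ≤
      ((∑ k ∈ Finset.Iic (m + n), (q * n.choose 2).choose k : ℕ) : ℝ) := by
    exact_mod_cast ncard_isRealizable_mul_factorial_le hm n
  have h2 := sum_choose_mul_pow_le_exp (q * n.choose 2) (m + n) (z := Q⁻¹) (by positivity)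
    (inv_le_one_of_one_le₀ hQ1)
  have h3 : Q⁻¹ * ((q * n.choose 2 : ℕ) : ℝ) ≤ n := by
    rw [inv_mul_le_iff₀ (by positivity)]
    push_cast
    rw [Nat.cast_choose_two, hQ]
    nlinarith
  have h4 : (n : ℝ) ^ n / n.factorial ≤ Real.exp n :=
    Real.pow_div_factorial_le_exp _ (by positivity) n
  have h5 : (R : ℝ) * n.factorial ≤ Real.exp n * Q ^ (m + n) := by
    have : (R : ℝ) * n.factorial * Q⁻¹ ^ (m + n) ≤ Real.exp n := by
      refine le_trans ?_ (h2.trans (Real.exp_le_exp.2 h3))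
      have hz : (0 : ℝ) ≤ Q⁻¹ ^ (m + n) := by positivity
      push_cast at h1 ⊢
      exact mul_le_mul_of_nonneg_right h1 hz
    rwa [inv_pow, mul_inv_le_iff₀ (by positivity)] at this
  have h6 : (n : ℝ) ^ n ≤ Real.exp n * n.factorial := by
    rwa [div_le_iff₀ (by positivity)] at h4
  have hnn : (0 : ℝ) < (n : ℝ) ^ n := by positivity
  refine le_of_mul_le_mul_right ?_ hnn
  have he : Real.exp 2 ^ n = Real.exp n * Real.exp n := by
    rw [← Real.exp_nat_mul, ← Real.exp_add]; ring_nf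
  calc (R : ℝ) * n ^ n ≤ R * (Real.exp n * n.factorial) := by gcongr
    _ = Real.exp n * (R * n.factorial) := by ring
    _ ≤ Real.exp n * (Real.exp n * Q ^ (m + n)) := by gcongr
    _ = _ := by rw [pow_add, mul_pow (Real.exp 2), he, hQ]; ring

open RectSYT

theorem realizableProb_nonneg (m n : ℕ) : 0 ≤ realizableProb m n := by
  unfold realizableProb; positivity

theorem realizableProb_le {m n : ℕ} (hm : 0 < m) (hn : 2 ≤ n) :
    realizableProb m n ≤
      (Real.exp 2 * ((m * (m - 1) + 1 : ℕ) / 2)) ^ n * ((m * (m - 1) + 1 : ℕ) / 2 * n) ^ m *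
        ((n + m - 1).choose n : ℝ) ^ m / (m : ℝ) ^ (m * n) := by
  have hS : (0 : ℝ) < Nat.card (RectSYT m n) := by exact_mod_cast Nat.card_pos
  have hlow : (m : ℝ) ^ (m * n) ≤ Nat.card (RectSYT m n) * ((n + m - 1).choose n : ℝ) ^ m := by
    exact_mod_cast pow_le_card_rectSYT_mul hm n
  have hup := ncard_isRealizable_le hm hn
  unfold realizableProb
  rw [div_le_div_iff₀ hS (by positivity)]
  calc _ ≤ _ := mul_le_mul hup hlow (by positivity) (by positivity)
    _ = _ := by ring

theorem exp_two_lt : Real.exp 2 < 7.4 := by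
  have h := Real.exp_one_lt_d9
  have : Real.exp 2 = Real.exp 1 * Real.exp 1 := by rw [← Real.exp_add]; norm_num
  rw [this]
  nlinarith [Real.exp_pos 1]

theorem mul_pred_add_one_le_sq {m : ℕ} (hm : 1 ≤ m) :
    ((m * (m - 1) + 1 : ℕ) : ℝ) ≤ (m : ℝ) ^ 2 := by
  have : m * (m - 1) + 1 ≤ m ^ 2 := by
    obtain ⟨k, rfl⟩ := Nat.exists_eq_add_of_le' hm
    simp only [Nat.add_sub_cancel]
    nlinarith
  exact_mod_cast this

/-- The exponential growth rate of the number of realizable tableaux with `m` rows is smaller than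
that of all tableaux. For `m = 3` this reads `7 e² / 2 < 27`. -/
theorem exp_two_mul_lt_pow {m : ℕ} (hm : 3 ≤ m) :
    Real.exp 2 * ((m * (m - 1) + 1 : ℕ) / 2) < (m : ℝ) ^ m := by
  have he := exp_two_lt
  rcases hm.eq_or_lt with rfl | hm4
  · norm_num
    linarith
  · have hm4' : (4 : ℝ) ≤ m := by exact_mod_cast hm4
    have hq := mul_pred_add_one_le_sq (m := m) (by omega)
    have hp : (m : ℝ) ^ 4 ≤ (m : ℝ) ^ m := pow_le_pow_right₀ (by linarith) hm4
    have : (16 : ℝ) ≤ (m : ℝ) ^ 2 := by nlinarith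
    have h1 : Real.exp 2 * ((m * (m - 1) + 1 : ℕ) / 2) ≤ 7.4 * ((m : ℝ) ^ 2 / 2) := by gcongr
    nlinarith

theorem tendsto_realizableProb_of_fixed_rows {m : ℕ} (hm : 3 ≤ m) :
    Tendsto (fun n => realizableProb m n) atTop (𝓝 0) := by
  set q : ℝ := ((m * (m - 1) + 1 : ℕ) : ℝ) / 2 with hq
  set r : ℝ := Real.exp 2 * q / (m : ℝ) ^ m with hr
  have hm0 : (0 : ℝ) < m := by exact_mod_cast (by omega : 0 < m)
  have hr0 : 0 ≤ r := by positivity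
  have hr1 : r < 1 := (div_lt_one (by positivity)).2 (exp_two_mul_lt_pow hm)
  have hlim : Tendsto (fun n : ℕ => q ^ m * ((m + 1 : ℝ) ^ m) ^ m *
      ((n : ℝ) ^ (m + m * m) * r ^ n)) atTop (𝓝 0) := by
    have := tendsto_pow_const_mul_const_pow_of_abs_lt_one (m + m * m)
      (by rwa [abs_of_nonneg hr0] : |r| < 1)
    simpa using this.const_mul (q ^ m * ((m + 1 : ℝ) ^ m) ^ m)
  refine squeeze_zero' (Eventually.of_forall fun n => realizableProb_nonneg m n) ?_ hlim
  filter_upwards [eventually_ge_atTop 2] with n hn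
  refine (realizableProb_le (by omega) hn).trans ?_
  have hn1 : (1 : ℝ) ≤ n := by exact_mod_cast (by omega : 1 ≤ n)
  have hC : ((n + m - 1).choose n : ℝ) ≤ ((m + 1) * n) ^ m := by
    have h1 : (n + m - 1).choose n = (n + m - 1).choose (m - 1) := by
      rw [← Nat.choose_symm (by omega : m - 1 ≤ n + m - 1)]
      congr 1; omega
    have h2 : (n + m - 1).choose n ≤ ((m + 1) * n) ^ m := by
      rw [h1]
      calc _ ≤ (n + m - 1) ^ (m - 1) := Nat.choose_le_pow _ _
        _ ≤ ((m + 1) * n) ^ (m - 1) := by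
            refine Nat.pow_le_pow_left ?_ _
            have : m * 1 ≤ m * n := Nat.mul_le_mul_left _ (by omega)
            rw [add_mul]; omega
        _ ≤ ((m + 1) * n) ^ m := Nat.pow_le_pow_right (Nat.mul_pos (by omega) (by omega)) (by omega)
    exact_mod_cast h2
  rw [div_le_iff₀ (by positivity)]
  calc (Real.exp 2 * q) ^ n * (q * n) ^ m * ((n + m - 1).choose n : ℝ) ^ m
      ≤ (Real.exp 2 * q) ^ n * (q * n) ^ m * (((m + 1) * n) ^ m) ^ m := by gcongr
    _ = q ^ m * ((m + 1 : ℝ) ^ m) ^ m * ((n : ℝ) ^ (m + m * m) * r ^ n) * (m : ℝ) ^ (m * n) := by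
      have : (Real.exp 2 * q) ^ n = r ^ n * (m : ℝ) ^ (m * n) := by
        rw [pow_mul, ← mul_pow, hr, div_mul_cancel₀ _ (by positivity)]
      rw [this, mul_pow ((m : ℝ) + 1), mul_pow (((m : ℝ) + 1) ^ m)]
      ring

/-- A bound that is uniform in the number of rows. It is far from sharp: the number of tableaux is
at least `(m / 4) ^ (m n)`, whereas that of the realizable ones is at most `(4 m²) ^ n (m² n) ^ m`. -/
theorem realizableProb_le_of_le {m n : ℕ} (hm : 64 ≤ m) (hmn : m ≤ n) :
    realizableProb m n ≤ (1 / 2) ^ n := by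
  refine (realizableProb_le (by omega) (by omega)).trans ?_
  have hm0 : (0 : ℝ) < m := by exact_mod_cast (by omega : 0 < m)
  rw [div_le_iff₀ (by positivity)]
  have he : Real.exp 2 ≤ 8 := exp_two_lt.le.trans (by norm_num)
  have hq := mul_pred_add_one_le_sq (m := m) (by omega)
  have hC : ((n + m - 1).choose n : ℝ) ≤ 4 ^ n := by
    have : (n + m - 1).choose n ≤ 4 ^ n := by
      calc _ ≤ 2 ^ (n + m - 1) := Nat.choose_le_two_pow _ _
        _ ≤ 2 ^ (2 * n) := Nat.pow_le_pow_right (by norm_num) (by omega)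
        _ = 4 ^ n := by rw [pow_mul]; norm_num
    exact_mod_cast this
  have hQ : ((m * (m - 1) + 1 : ℕ) : ℝ) / 2 * n ≤ 2 ^ n := by
    have hcube : ∀ k : ℕ, 10 ≤ k → k ^ 3 ≤ 2 ^ k := by
      intro k hk
      induction k, hk using Nat.le_induction with
      | base => norm_num
      | succ k hk ih => rw [pow_succ 2]; nlinarith [Nat.mul_le_mul hk hk]
    have h1 : (n : ℝ) ^ 3 ≤ 2 ^ n := by exact_mod_cast hcube n (by omega)
    have h2 : (m : ℝ) ≤ n := by exact_mod_cast hmn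
    calc ((m * (m - 1) + 1 : ℕ) : ℝ) / 2 * n ≤ (m : ℝ) ^ 2 * n := by
          gcongr
          linarith [hq, sq_nonneg (m : ℝ)]
      _ ≤ (n : ℝ) ^ 2 * n := by gcongr
      _ = (n : ℝ) ^ 3 := by ring
      _ ≤ 2 ^ n := h1
  have hpow : 8 * (m : ℝ) ^ 2 * 8 ^ m ≤ (m : ℝ) ^ m := by
    have h64 : (64 : ℝ) ≤ m := by exact_mod_cast hm
    have h1 : (8 : ℝ) ^ m ≤ (m : ℝ) ^ (m - 4) := by
      calc (8 : ℝ) ^ m ≤ 8 ^ (2 * (m - 4)) := pow_le_pow_right₀ (by norm_num) (by omega)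
        _ = 64 ^ (m - 4) := by rw [pow_mul]; norm_num
        _ ≤ _ := by gcongr
    have h2 : 8 * (m : ℝ) ^ 2 ≤ (m : ℝ) ^ 4 := by
      have h3 : (8 : ℝ) ≤ (m : ℝ) ^ 2 := by nlinarith
      calc 8 * (m : ℝ) ^ 2 ≤ (m : ℝ) ^ 2 * (m : ℝ) ^ 2 := by gcongr
        _ = _ := by ring
    calc _ ≤ (m : ℝ) ^ 4 * (m : ℝ) ^ (m - 4) := by gcongr
      _ = _ := by rw [← pow_add]; congr 1; omega
  have h2 : (1 / 2 : ℝ) ^ n * 2 ^ n = 1 := by rw [← mul_pow]; norm_num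
  calc (Real.exp 2 * ((m * (m - 1) + 1 : ℕ) / 2)) ^ n * ((m * (m - 1) + 1 : ℕ) / 2 * n) ^ m *
        ((n + m - 1).choose n : ℝ) ^ m
      ≤ (8 * ((m : ℝ) ^ 2 / 2)) ^ n * (2 ^ n) ^ m * (4 ^ n) ^ m := by gcongr
    _ = (1 / 2) ^ n * 2 ^ n * ((8 * ((m : ℝ) ^ 2 / 2)) ^ n * (2 ^ n) ^ m * (4 ^ n) ^ m) := by
      rw [h2, one_mul]
    _ = (1 / 2) ^ n * (8 * (m : ℝ) ^ 2 * 8 ^ m) ^ n := by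
      have h8 : ((8 : ℝ) ^ m) ^ n = (2 ^ n) ^ m * (4 ^ n) ^ m := by
        rw [← mul_pow, ← mul_pow, ← pow_mul, ← pow_mul, mul_comm m n]; norm_num
      have h9 : (8 * (m : ℝ) ^ 2) ^ n = 2 ^ n * (8 * ((m : ℝ) ^ 2 / 2)) ^ n := by
        rw [← mul_pow]; congr 1; ring
      rw [mul_pow _ ((8 : ℝ) ^ m), h8, h9]
      ring
    _ ≤ (1 / 2) ^ n * ((m : ℝ) ^ m) ^ n := by gcongr
    _ = _ := by rw [← pow_mul]

theorem mainTheorem4 (m : ℕ → ℕ) (hm : ∀ n, 3 ≤ m n) :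
    Tendsto
      (fun n : ℕ =>
        (ProbabilityTheory.uniformOn (Set.univ : Set (RectSYT (m n) n))).real
          {T : RectSYT (m n) n | T.IsRealizable})
      atTop (𝓝 0) := by
  simp only [uniformOn_real_isRealizable]
  have hbound : ∀ᶠ n in atTop, realizableProb (m n) n ≤
      (1 / 2) ^ n + ∑ k ∈ Finset.Ico 3 64, realizableProb k n := by
    filter_upwards [eventually_ge_atTop 64] with n hn
    have hsum : 0 ≤ ∑ k ∈ Finset.Ico 3 64, realizableProb k n :=
      Finset.sum_nonneg fun k _ => realizableProb_nonneg k n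
    rcases lt_or_ge (m n) 64 with hlt | hge
    · have := Finset.single_le_sum (f := fun k => realizableProb k n)
        (fun k _ => realizableProb_nonneg k n) (Finset.mem_Ico.2 ⟨hm n, hlt⟩)
      have h2 : (0 : ℝ) ≤ (1 / 2) ^ n := by positivity
      linarith
    · rcases le_total (m n) n with h | h
      · linarith [realizableProb_le_of_le hge h]
      · have h1 := realizableProb_le_of_le hn h
        have h2 : (1 / 2 : ℝ) ^ m n ≤ (1 / 2) ^ n :=
          pow_le_pow_of_le_one (by norm_num) (by norm_num) h
        rw [realizableProb_comm]
        linarith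
  refine squeeze_zero' (Eventually.of_forall fun n => realizableProb_nonneg _ n) hbound ?_
  have h1 : Tendsto (fun n : ℕ => (1 / 2 : ℝ) ^ n) atTop (𝓝 0) :=
    tendsto_pow_atTop_nhds_zero_of_lt_one (by norm_num) (by norm_num)
  have h2 : Tendsto (fun n : ℕ => ∑ k ∈ Finset.Ico 3 64, realizableProb k n) atTop
      (𝓝 (∑ k ∈ Finset.Ico 3 64, 0)) :=
    tendsto_finsetSum _ fun k hk => tendsto_realizableProb_of_fixed_rows (Finset.mem_Ico.1 hk).1
  simpa using h1.add h2
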